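/- Let $D\ge 2$, let $\mathcal D$ be the set of density matrices on $\mathbb C^D$, and let $\mathcal M$ be a quantum channel on the complex $D\times D$ matrices, i.e. a completely positive, trace preserving linear map. For a unitary $U$ let $\mathcal I_U\subset\mathcal D$ be the set of states that are diagonal in the basis $|b_j\rangle = U|j\rangle$, let $$C_U(\rho)=\frac1{D-1}\min_{\tau\in\mathcal D}\Big\{s\ge 0 \;\Big|\; \frac{\rho+s\tau}{1+s}\in\mathcal I_U\Big\}$$ be the normalized robustness of coherence, and for $\vec\alpha\in\mathbb R^D$ let $|\Psi_U^{\vec\alpha}\rangle=\frac1{\sqrt D}\sum_j e^{i\alpha_j}|b_j\rangle$ be the maximally coherent states for $U$. Define $$Q_-(\mathcal M)=\min_{U,U'}\max_{\vec\alpha} C_{U'}\big[\mathcal M(|\Psi_U^{\vec\alpha}\rangle\langle\Psi_U^{\vec\alpha}|)\big],\quad Q_0(\mathcal M)=\min_{U}\max_{\vec\alpha} C_{U}\big[\mathcal M(|\Psi_U^{\vec\alpha}\rangle\langle\Psi_U^{\vec\alpha}|)\big],\quad Q_+(\mathcal M)=\min_{U}\max_{\rho\in\mathcal D} C_{U}[\mathcal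 M(\rho)].$$ If $Q_-(\mathcal M)=1$ or $Q_0(\mathcal M)=1$ or $Q_+(\mathcal M)=1$, then $\mathcal M$ is a unitary channel: there is a unitary $V$ with $\mathcal M(\rho)=V\rho V^\dagger$ for all $\rho$. The same holds, with $\min$ and $\max$ read as infimum and supremum, if $C_U$ is replaced by any family of functions $C_U:\mathcal D\to[0,1]$ (one for each unitary $U$), each continuous and convex, such that $C_U(\rho)=1$ exactly when $\rho=|\Psi_U^{\vec\alpha}\rangle\langle\Psi_U^{\vec\alpha}|$ for some $\vec\alpha$. -/

import Mathlib

namespace QuantumMemory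

noncomputable section

/-- Operators on the `D`-dimensional Hilbert space `ℂ ^ D`. -/
abbrev Op (D : ℕ) : Type := Matrix (Fin D) (Fin D) ℂ

/-- Unitary `D × D` matrices. The unitary `U` stands for the orthonormal basis
`|b_j⟩ = U |j⟩` formed by its columns. -/
abbrev Uni (D : ℕ) : Type := Matrix.unitaryGroup (Fin D) ℂ

section Channel

open scoped ComplexOrder Matrix.Norms.L2Operator MatrixOrder

/-- Quantum channels: completely positive, trace preserving linear maps on the `D × D` matrices,
these being ordered by the positive semidefinite cone. -/
structure Channel (D : ℕ) extends CompletelyPositiveMap (Op D) (Op D) where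
  trace_map : ∀ A : Op D, Matrix.trace (toFun A) = Matrix.trace A

end Channel

instance (D : ℕ) : CoeFun (Channel D) (fun _ => Op D → Op D) where
  coe M := M.toFun

/-- `M` is a unitary channel: `M(ρ) = V ρ V†` for some unitary `V`. -/
def Channel.IsUnitary {D : ℕ} (M : Channel D) : Prop :=
  ∃ V : Uni D, ∀ ρ : Op D, M ρ = (V : Op D) * ρ * (V : Op D).conjTranspose

section States

open scoped ComplexOrder

/-- The set of quantum states (density matrices). -/
def states (D : ℕ) : Set (Op D) :=
  {ρ | ρ.PosSemidef ∧ ρ.trace = 1}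

end States

/-- The set of states that are incoherent (diagonal) with respect to the basis `U |j⟩`. -/
def incoherent {D : ℕ} (U : Uni D) : Set (Op D) :=
  {ρ | ρ ∈ states D ∧ ((U : Op D).conjTranspose * ρ * (U : Op D)).IsDiag}

/-- The normalized robustness of coherence of `ρ` with respect to the basis `U |j⟩`. -/
def robustness {D : ℕ} (U : Uni D) (ρ : Op D) : ℝ :=
  1 / ((D : ℝ) - 1) *
    sInf {s : ℝ | 0 ≤ s ∧ ∃ τ ∈ states D, (1 + s)⁻¹ • (ρ + s • τ) ∈ incoherent U}

/-- The vector `D^{-1/2} ∑_j e^{i α_j} |b_j⟩`, where `|b_j⟩ = U |j⟩`. -/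
def maxCohVec {D : ℕ} (U : Uni D) (α : Fin D → ℝ) : Fin D → ℂ :=
  ((Real.sqrt D : ℝ) : ℂ)⁻¹ •
    (U : Op D).mulVec (fun j => Complex.exp ((α j : ℂ) * Complex.I))

/-- The maximally coherent state with phases `α` in the basis `U |j⟩`, as a density matrix. -/
def maxCoh {D : ℕ} (U : Uni D) (α : Fin D → ℝ) : Op D :=
  Matrix.vecMulVec (maxCohVec U α) (star (maxCohVec U α))

/-- `Q₋` with respect to a family `C` of coherence measures, one for each basis `U`. -/
def Qminus {D : ℕ} (C : Uni D → Op D → ℝ) (M : Channel D) : ℝ :=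
  ⨅ UU : Uni D × Uni D, ⨆ α : Fin D → ℝ, C UU.2 (M (maxCoh UU.1 α))

/-- `Q₀` with respect to a family `C` of coherence measures, one for each basis `U`. -/
def Qzero {D : ℕ} (C : Uni D → Op D → ℝ) (M : Channel D) : ℝ :=
  ⨅ U : Uni D, ⨆ α : Fin D → ℝ, C U (M (maxCoh U α))

/-- `Q₊` with respect to a family `C` of coherence measures, one for each basis `U`. -/
def Qplus {D : ℕ} (C : Uni D → Op D → ℝ) (M : Channel D) : ℝ :=
  ⨅ U : Uni D, ⨆ ρ : states D, C U (M ρ)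

/-- The coherence measures, normalized to `[0, 1]`, that may replace the robustness: for each
basis, continuous and convex on states, with maximal value `1`, which is attained exactly at the
maximally coherent states. No further axiom of a coherence measure is imposed. -/
structure IsCoherenceMeasure {D : ℕ} (C : Uni D → Op D → ℝ) : Prop where
  mem_Icc : ∀ U, ∀ ρ ∈ states D, C U ρ ∈ Set.Icc (0 : ℝ) 1
  continuousOn : ∀ U, ContinuousOn (C U) (states D)
  convexOn : ∀ U, ConvexOn ℝ (states D) (C U)
  eq_one_iff : ∀ U, ∀ ρ ∈ states D, C U ρ = 1 ↔ ∃ α : Fin D → ℝ, ρ = maxCoh U α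

end

end QuantumMemory

/-!
In the basis `U |j⟩`, the robustness of `ρ` is, up to normalization, the excess over `1` of the
least trace of a diagonal matrix that dominates `ρ`. Since the row sums `∑ j, ‖ρ i j‖` form such a
diagonal, that trace is at most `∑ i, ∑ j, ‖ρ i j‖`, and hence at most `D` on writing `ρ` as a Gram
matrix; equality forces the Gram vectors to be unimodular multiples of each other, so `ρ` is
maximally coherent.

If some `Q` equals `1` then, by compactness, for every `U` the channel has an output that is
maximally coherent for `U`. Let `K i` be its Kraus operators. An output is a pure state `y y†` only
if some `x ≠ 0` satisfies `K i x = a i • y` for all `i`. When such `y` do not span, they lie in a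
hyperplane. When they do, pick a basis of them: if the vectors `a` that belong to the basis elements
are proportional, all `K i` are multiples of one operator and the channel is unitary, and otherwise
one of two fixed coordinates of every such `y` vanishes. A channel that is not unitary thus has all
its pure outputs in the union of two hyperplanes. Finally, some `U` has no maximally coherent vector
in that union: let the normals `v` and `w` lie in the span of two basis vectors, each with
coordinates of different absolute values, which no choice of phases can make cancel.
-/

section PureOutputs

open Module

variable {K E F ι : Type*} [Field K] [AddCommGroup E] [Module K E] [AddCommGroup F] [Module K F]

/-- The vectors `y` such that `∑ i, T i x ⊗ e i` is a pure tensor `y ⊗ a` for some `x ≠ 0`. When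
the `T i` are the Kraus operators of a quantum channel, these include all vectors whose pure state
is an output of the channel. -/
def pureOutputs (T : ι → E →ₗ[K] F) : Set F :=
  {y | ∃ x ≠ 0, ∃ a : ι → K, ∀ i, T i x = a i • y}

variable {T : ι → E →ₗ[K] F} {κ : Type*} {a : κ → ι → K}

theorem linearIndependent_of_map_eq_smul {x : κ → E} {y : κ → F} (hy : LinearIndependent K y)
    (ha : ∀ k, a k ≠ 0) (h : ∀ k i, T i (x k) = a k i • y k) : LinearIndependent K x := by
  rw [linearIndependent_iff']
  intro s c hc k hk
  obtain ⟨i, hi⟩ := Function.ne_iff.1 (ha k)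
  have hci : ∑ l ∈ s, (c l * a l i) • y l = 0 := by
    simpa only [map_sum, map_smul, h, smul_smul, map_zero] using congrArg (T i) hc
  exact (mul_eq_zero.1 (linearIndependent_iff'.1 hy s _ hci k hk)).resolve_right hi

theorem exists_map_eq_smul_of_proportional (x : Basis κ K E) {y : κ → F}
    (h : ∀ k i, T i (x k) = a k i • y k) {b : ι → K} {r : κ → K} (hr : ∀ k, a k = r k • b) :
    ∃ V : E →ₗ[K] F, ∀ i, T i = b i • V := by
  refine ⟨x.constr K fun k => r k • y k, fun i => x.ext fun k => ?_⟩
  rw [LinearMap.smul_apply, x.constr_basis, h, hr, Pi.smul_apply, smul_eq_mul, smul_smul, mul_comm]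

theorem repr_mul_eq_mul_repr (x : Basis κ K E) (y : Basis κ K F)
    (h : ∀ k i, T i (x k) = a k i • y k) {z : E} {w : F} {c : ι → K}
    (hz : ∀ i, T i z = c i • w) (k : κ) (i : ι) : x.repr z k * a k i = c i * y.repr w k := by
  have hdiag : y.coord k ∘ₗ T i = a k i • x.coord k := by
    refine x.ext fun l => ?_
    by_cases hl : l = k
    · simp [h, hl]
    · simp [h, Finsupp.single_eq_of_ne' hl]
  simpa [hz, mul_comm] using (LinearMap.congr_fun hdiag z).symm

theorem repr_eq_zero_or_of_mem_pureOutputs (hT : ∀ x ≠ 0, ∃ i, T i x ≠ 0) (x : Basis κ K E)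
    (y : Basis κ K F) (h : ∀ k i, T i (x k) = a k i • y k) {k l : κ}
    (hkl : ¬∃ r : K, a l = r • a k) {w : F} (hw : w ∈ pureOutputs T) :
    y.repr w k = 0 ∨ y.repr w l = 0 := by
  obtain ⟨z, hz, c, hc⟩ := hw
  by_contra! hne
  obtain ⟨hwk, hwl⟩ := hne
  have hrepr := repr_mul_eq_mul_repr x y h hc
  obtain ⟨j, hj⟩ := hT z hz
  have hcj : c j ≠ 0 := fun h0 => hj (by rw [hc, h0, zero_smul])
  have hzl : x.repr z l ≠ 0 := fun h0 =>
    mul_ne_zero hcj hwl (by rw [← hrepr, h0, zero_mul])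
  refine hkl ⟨(x.repr z l)⁻¹ * y.repr w l * (y.repr w k)⁻¹ * x.repr z k, funext fun i => ?_⟩
  rw [Pi.smul_apply, smul_eq_mul]
  field_simp
  linear_combination y.repr w k * hrepr l i - y.repr w l * hrepr k i

theorem exists_dual_or_exists_map_eq_smul_of_basis [Finite κ] [Nonempty κ]
    (hEF : finrank K E = finrank K F) (hT : ∀ x ≠ 0, ∃ i, T i x ≠ 0) (y : Basis κ K F)
    (hy : ∀ k, y k ∈ pureOutputs T) :
    (∃ f ≠ (0 : Dual K F), ∃ g ≠ (0 : Dual K F), ∀ w ∈ pureOutputs T, f w = 0 ∨ g w = 0) ∨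
      ∃ (b : ι → K) (V : E →ₗ[K] F), ∀ i, T i = b i • V := by
  have := Fintype.ofFinite κ
  choose x hx0 a hxy using hy
  have ha : ∀ k, a k ≠ 0 := fun k hk => by
    obtain ⟨i, hi⟩ := hT _ (hx0 k)
    exact hi (by rw [hxy, hk, Pi.zero_apply, zero_smul])
  have hx := linearIndependent_of_map_eq_smul y.linearIndependent ha hxy
  obtain ⟨x, rfl⟩ : ∃ x' : Basis κ K E, ⇑x' = x :=
    ⟨basisOfLinearIndependentOfCardEqFinrank hx (by rw [hEF, finrank_eq_card_basis y]),
      coe_basisOfLinearIndependentOfCardEqFinrank hx _⟩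
  obtain ⟨k₀⟩ := ‹Nonempty κ›
  by_cases hprop : ∀ k, ∃ r : K, a k = r • a k₀
  · choose r hr using hprop
    exact Or.inr ⟨a k₀, exists_map_eq_smul_of_proportional x hxy hr⟩
  · obtain ⟨k, hk⟩ := not_forall.1 hprop
    have hcoord : ∀ l, y.coord l ≠ 0 := fun l h => by simpa using LinearMap.congr_fun h (y l)
    exact Or.inl ⟨y.coord k₀, hcoord k₀, y.coord k, hcoord k,
      fun w hw => repr_eq_zero_or_of_mem_pureOutputs hT x y hxy hk hw⟩

theorem exists_dual_or_exists_map_eq_smul [FiniteDimensional K F] [Nontrivial F]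
    (hEF : finrank K E = finrank K F) (hT : ∀ x ≠ 0, ∃ i, T i x ≠ 0) :
    (∃ f ≠ (0 : Dual K F), ∃ g ≠ (0 : Dual K F), ∀ w ∈ pureOutputs T, f w = 0 ∨ g w = 0) ∨
      ∃ (b : ι → K) (V : E →ₗ[K] F), ∀ i, T i = b i • V := by
  by_cases hspan : Submodule.span K (pureOutputs T) = ⊤
  · let y := Basis.ofSpan hspan.ge
    have := Module.Finite.finite_basis y
    have := y.index_nonempty
    exact exists_dual_or_exists_map_eq_smul_of_basis hEF hT y
      fun k => Basis.ofSpan_subset hspan.ge ⟨k, rfl⟩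
  · obtain ⟨f, hf, hle⟩ := Submodule.exists_le_ker_of_lt_top _ (lt_top_iff_ne_top.2 hspan)
    exact Or.inl ⟨f, hf, f, hf, fun w hw => Or.inl (hle (Submodule.subset_span hw))⟩

end PureOutputs

section RankOne

open Matrix
open scoped ComplexOrder

variable {n ι : Type*} [Fintype ι]

theorem star_dotProduct_eq_zero_of_sum_vecMulVec_eq [Fintype n] {v : ι → n → ℂ} {y z : n → ℂ}
    (h : ∑ i, vecMulVec (v i) (star (v i)) = vecMulVec y (star y)) (hz : star z ⬝ᵥ y = 0)
    (i : ι) : star z ⬝ᵥ v i = 0 := by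
  have hquad : ∀ w : n → ℂ,
      star z ⬝ᵥ vecMulVec w (star w) *ᵥ z = ((‖star z ⬝ᵥ w‖ ^ 2 : ℝ) : ℂ) := fun w => by
    rw [vecMulVec_mulVec, op_smul_eq_smul, dotProduct_smul, smul_eq_mul, star_dotProduct w z,
      Complex.star_def, Complex.conj_mul', Complex.ofReal_pow]
  have hsum : ∑ j, ‖star z ⬝ᵥ v j‖ ^ 2 = 0 := by
    have hz' := congrArg (fun A => star z ⬝ᵥ A *ᵥ z) h
    simp only [sum_mulVec, dotProduct_sum, hquad, hz, norm_zero, zero_pow two_ne_zero] at hz'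
    exact_mod_cast hz'
  rw [Finset.sum_eq_zero_iff_of_nonneg fun _ _ => sq_nonneg _] at hsum
  simpa using hsum i (Finset.mem_univ i)

theorem exists_eq_smul_of_sum_vecMulVec_eq [Finite n] {v : ι → n → ℂ} {y : n → ℂ}
    (h : ∑ i, vecMulVec (v i) (star (v i)) = vecMulVec y (star y)) (i : ι) :
    ∃ c : ℂ, v i = c • y := by
  have := Fintype.ofFinite n
  let c : ℂ := star (star (v i) ⬝ᵥ y / (star y ⬝ᵥ y))
  have hy : star (v i - c • y) ⬝ᵥ y = 0 := by
    rw [star_sub, star_smul, star_star, sub_dotProduct, smul_dotProduct, smul_eq_mul,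
      div_mul_cancel_of_imp, sub_self]
    exact fun hyy => by rw [dotProduct_star_self_eq_zero.1 hyy, dotProduct_zero]
  have hv : star (v i - c • y) ⬝ᵥ v i = 0 := star_dotProduct_eq_zero_of_sum_vecMulVec_eq h hy i
  have hself : star (v i - c • y) ⬝ᵥ (v i - c • y) = 0 := by
    rw [dotProduct_sub, dotProduct_smul, hv, hy, smul_zero, sub_zero]
  exact ⟨c, sub_eq_zero.1 (dotProduct_star_self_eq_zero.1 hself)⟩

end RankOne

section KrausFamily

open Matrix

variable {m n ι : Type*} [Fintype n]

theorem mul_vecMulVec_star_mul_conjTranspose (K : Matrix m n ℂ) (x y : n → ℂ) :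
    K * vecMulVec x (star y) * Kᴴ = vecMulVec (K *ᵥ x) (star (K *ᵥ y)) := by
  rw [mul_vecMulVec, vecMulVec_mul, star_mulVec]

theorem mul_single_one_mul_conjTranspose [DecidableEq n] (K : Matrix m n ℂ) (i j : n) :
    K * single i j (1 : ℂ) * Kᴴ = vecMulVec (K.col i) (star (K.col j)) := by
  rw [single_eq_single_vecMulVec_single, ← mulVec_single_one, ← mulVec_single_one,
    ← mul_vecMulVec_star_mul_conjTranspose, ← Pi.single_star, star_one]

variable [Fintype ι]

/-- `K` is a family of Kraus operators of the map `Φ` between matrix algebras. -/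
def IsKrausFamily (K : ι → Matrix m n ℂ) (Φ : Matrix n n ℂ → Matrix m m ℂ) : Prop :=
  ∀ A, Φ A = ∑ i, K i * A * (K i)ᴴ

theorem isKrausFamily_of_map_single [DecidableEq n] {K : ι → Matrix m n ℂ}
    {Φ : Matrix n n ℂ →ₗ[ℂ] Matrix m m ℂ}
    (h : ∀ i j, Φ (single i j 1) = ∑ k, K k * single i j (1 : ℂ) * (K k)ᴴ) : IsKrausFamily K Φ := by
  let Ψ : Matrix n n ℂ →ₗ[ℂ] Matrix m m ℂ :=
    ∑ k, mulRightLinearMap m ℂ (K k)ᴴ ∘ₗ mulLeftLinearMap n ℂ (K k)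
  have hΨ : ∀ A, Ψ A = ∑ k, K k * A * (K k)ᴴ := fun A => by simp [Ψ]
  have hΦΨ : Φ = Ψ := ext_linearMap _ fun i j => LinearMap.ext_ring ((h i j).trans (hΨ _).symm)
  exact fun A => hΦΨ ▸ hΨ A

section

open scoped ComplexOrder

variable {K : ι → Matrix m n ℂ} {Φ : Matrix n n ℂ → Matrix m m ℂ}

theorem IsKrausFamily.map_vecMulVec_star (hK : IsKrausFamily K Φ) (x : n → ℂ) :
    Φ (vecMulVec x (star x)) = ∑ i, vecMulVec (K i *ᵥ x) (star (K i *ᵥ x)) := by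
  rw [hK]
  exact Finset.sum_congr rfl fun i _ => mul_vecMulVec_star_mul_conjTranspose _ _ _

theorem IsKrausFamily.posSemidef_map [Finite m] (hK : IsKrausFamily K Φ)
    {A : Matrix n n ℂ} (hA : A.PosSemidef) : (Φ A).PosSemidef := by
  rw [hK]
  exact posSemidef_sum _ fun i _ => hA.mul_mul_conjTranspose_same _

theorem IsKrausFamily.continuous (hK : IsKrausFamily K Φ) : Continuous Φ := by
  rw [funext hK]
  fun_prop

theorem IsKrausFamily.exists_mulVec_ne_zero [Fintype m] (hK : IsKrausFamily K Φ)
    (hΦ : ∀ A, (Φ A).trace = A.trace) {x : n → ℂ} (hx : x ≠ 0) : ∃ i, K i *ᵥ x ≠ 0 := by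
  by_contra! h
  have htr := hΦ (vecMulVec x (star x))
  simp only [hK.map_vecMulVec_star, h, zero_vecMulVec, Finset.sum_const_zero, trace_zero,
    trace_vecMulVec] at htr
  exact hx (dotProduct_self_star_eq_zero.1 htr.symm)

theorem IsKrausFamily.mem_pureOutputs [Finite m] (hK : IsKrausFamily K Φ) {A : Matrix n n ℂ}
    (hA : A.PosSemidef) (hA0 : A ≠ 0) {y : m → ℂ} (hy : Φ A = vecMulVec y (star y)) :
    y ∈ pureOutputs fun i => (K i).mulVecLin := by
  obtain ⟨N, x, rfl⟩ := posSemidef_iff_eq_sum_vecMulVec.1 hA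
  obtain ⟨k, -, hk⟩ := Finset.exists_ne_zero_of_sum_ne_zero hA0
  have hxk : x k ≠ 0 := by
    rintro h
    simp [h] at hk
  have hsum : ∑ p : ι × Fin N, vecMulVec (K p.1 *ᵥ x p.2) (star (K p.1 *ᵥ x p.2)) =
      vecMulVec y (star y) := by
    rw [← hy, hK, Fintype.sum_prod_type]
    simp only [Matrix.mul_sum, Matrix.sum_mul, mul_vecMulVec_star_mul_conjTranspose]
  choose c hc using fun i => exists_eq_smul_of_sum_vecMulVec_eq hsum (i, k)
  exact ⟨x k, hxk, c, hc⟩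

theorem IsKrausFamily.exists_map_eq_mul_mul_conjTranspose {a : ι → ℂ} {V : Matrix m n ℂ}
    (hK : IsKrausFamily (fun i => a i • V) Φ) : ∃ W : Matrix m n ℂ, ∀ A, Φ A = W * A * Wᴴ := by
  have hs : ((√(∑ i, ‖a i‖ ^ 2) : ℝ) : ℂ) * √(∑ i, ‖a i‖ ^ 2) = ∑ i, a i * star (a i) := by
    rw [← Complex.ofReal_mul, Real.mul_self_sqrt (by positivity)]
    simp [Complex.mul_conj']
  refine ⟨((√(∑ i, ‖a i‖ ^ 2) : ℝ) : ℂ) • V, fun A => ?_⟩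
  simp only [hK A, conjTranspose_smul, Matrix.smul_mul, Matrix.mul_smul, smul_smul,
    ← Finset.sum_smul, Complex.star_def, Complex.conj_ofReal, hs, mul_comm]

theorem conjTranspose_mul_self_eq_one_of_trace_mul_mul_conjTranspose [Fintype m]
    [DecidableEq n] {W : Matrix m n ℂ} (hW : ∀ A : Matrix n n ℂ, (W * A * Wᴴ).trace = A.trace) :
    Wᴴ * W = 1 := by
  refine ext_iff_trace_mul_right.2 fun A => ?_
  rw [Matrix.one_mul, ← hW A, trace_mul_comm (W * A), Matrix.mul_assoc]

end

section CompletelyPositive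

open scoped ComplexOrder Matrix.Norms.L2Operator MatrixOrder CStarAlgebra

variable [Fintype m] [DecidableEq m] [DecidableEq n]

-- Stated over an abstract algebra because instance search for the functional calculus that the
-- library lemma asks for fails at `CStarMatrix n n (Matrix m m ℂ)`.
theorem exists_eq_star_mul_self_of_nonneg {A : Type*} [NonUnitalCStarAlgebra A] [PartialOrder A]
    [StarOrderedRing A] {a : A} (ha : 0 ≤ a) : ∃ b : A, a = star b * b :=
  CStarAlgebra.nonneg_iff_eq_star_mul_self.mp ha

theorem exists_map_single_eq_sum (Φ : Matrix n n ℂ →CP Matrix m m ℂ) :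
    ∃ B : n → n → Matrix m m ℂ, ∀ i j, Φ (single i j 1) = ∑ k, (B k i)ᴴ * B k j := by
  rcases isEmpty_or_nonempty n with _ | ⟨⟨z⟩⟩
  · exact ⟨0, isEmptyElim⟩
  let R : CStarMatrix n n (Matrix n n ℂ) :=
    CStarMatrix.ofMatrix (Matrix.of fun k j => if k = z then single z j 1 else 0)
  have hR : ∀ i j, (star R * R) i j = single i j 1 := fun i j => by
    rw [CStarMatrix.mul_apply, Finset.sum_eq_single_of_mem z (Finset.mem_univ z)]
    · simp [CStarMatrix.star_apply, R, star_eq_conjTranspose]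
    · intro k _ hk
      simp [R, hk]
  obtain ⟨B, hB⟩ := exists_eq_star_mul_self_of_nonneg
    (Φ.map_cstarMatrix_nonneg _ (star_mul_self_nonneg R))
  refine ⟨fun k i => B k i, fun i j => ?_⟩
  have hBij := congrFun (congrFun hB i) j
  rw [CStarMatrix.map_apply, hR, CStarMatrix.mul_apply] at hBij
  simpa only [CStarMatrix.star_apply, star_eq_conjTranspose] using hBij

theorem exists_isKrausFamily (Φ : Matrix n n ℂ →CP Matrix m m ℂ) :
    ∃ K : n × m → Matrix m n ℂ, IsKrausFamily K Φ := by
  obtain ⟨B, hB⟩ := exists_map_single_eq_sum Φ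
  refine ⟨fun p => Matrix.of fun x i => star (B p.1 i p.2 x),
    isKrausFamily_of_map_single (Φ := (Φ : Matrix n n ℂ →ₗ[ℂ] Matrix m m ℂ)) fun i j => ?_⟩
  ext x y
  simp only [mul_single_one_mul_conjTranspose]
  refine (congrFun (congrFun (hB i j) x) y).trans ?_
  simp [Matrix.sum_apply, Matrix.mul_apply, vecMulVec_apply, Fintype.sum_prod_type]

end CompletelyPositive

end KrausFamily

section OrthonormalPair

variable {𝕜 E : Type*} [RCLike 𝕜] [NormedAddCommGroup E] [InnerProductSpace 𝕜 E]

theorem orthonormal_pair_iff {e f : E} :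
    Orthonormal 𝕜 ![e, f] ↔ ‖e‖ = 1 ∧ ‖f‖ = 1 ∧ inner 𝕜 e f = 0 := by
  simp [orthonormal_vecCons_iff, and_comm, and_left_comm]

variable (𝕜) in
theorem exists_norm_eq_one_eq_norm_smul [Nontrivial E] (x : E) :
    ∃ u : E, ‖u‖ = 1 ∧ x = (‖x‖ : 𝕜) • u := by
  rcases eq_or_ne x 0 with rfl | hx
  · obtain ⟨z, hz⟩ := exists_ne (0 : E)
    exact ⟨(‖z‖⁻¹ : 𝕜) • z, norm_smul_inv_norm hz, by simp⟩
  · have hx' : (‖x‖ : 𝕜) ≠ 0 := by simpa using hx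
    exact ⟨(‖x‖⁻¹ : 𝕜) • x, norm_smul_inv_norm hx, (smul_inv_smul₀ hx' x).symm⟩

theorem exists_orthonormal_pair_eq_smul_add_smul (hE : 2 ≤ Module.finrank 𝕜 E) {e : E}
    (he : ‖e‖ = 1) (w : E) :
    ∃ f : E, Orthonormal 𝕜 ![e, f] ∧ ∃ c s : 𝕜, w = c • e + s • f := by
  have : FiniteDimensional 𝕜 E := Module.finite_of_finrank_pos (by omega)
  have he0 : e ≠ 0 := by rintro rfl; simp at he
  have : Nontrivial (𝕜 ∙ e)ᗮ := by
    have hrank := Submodule.finrank_add_finrank_orthogonal (𝕜 ∙ e)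
    rw [finrank_span_singleton he0] at hrank
    exact Module.nontrivial_of_finrank_pos (R := 𝕜) (by omega)
  have hwe : w - inner 𝕜 e w • e ∈ (𝕜 ∙ e)ᗮ := by
    rw [Submodule.mem_orthogonal_singleton_iff_inner_right, inner_sub_right, inner_smul_right,
      inner_self_eq_norm_sq_to_K, he]
    simp
  obtain ⟨⟨f, hfe⟩, hf, hwf⟩ := exists_norm_eq_one_eq_norm_smul 𝕜 (⟨_, hwe⟩ : (𝕜 ∙ e)ᗮ)
  refine ⟨f, orthonormal_pair_iff.2 ⟨he, hf, Submodule.mem_orthogonal_singleton_iff_inner_right.1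
    hfe⟩, inner 𝕜 e w, (‖w - inner 𝕜 e w • e‖ : 𝕜), ?_⟩
  rw [add_comm, ← sub_eq_iff_eq_add]
  exact congrArg Subtype.val hwf

theorem orthonormal_rotate {e f : E} (h : Orthonormal 𝕜 ![e, f]) {a b : ℝ}
    (hab : a ^ 2 + b ^ 2 = 1) :
    Orthonormal 𝕜 ![(a : 𝕜) • e + (b : 𝕜) • f, (-b : 𝕜) • e + (a : 𝕜) • f] := by
  obtain ⟨he, hf, hef⟩ := orthonormal_pair_iff.1 h
  have hfe : inner 𝕜 f e = 0 := inner_eq_zero_symm.1 hef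
  have hnorm : ∀ c d : ℝ, c ^ 2 + d ^ 2 = 1 → ‖(c : 𝕜) • e + (d : 𝕜) • f‖ = 1 := fun c d hcd => by
    have hsq : ‖(c : 𝕜) • e + (d : 𝕜) • f‖ ^ 2 = 1 := by
      rw [sq, norm_add_sq_eq_norm_sq_add_norm_sq_of_inner_eq_zero (𝕜 := 𝕜)]
      · rw [norm_smul, norm_smul, he, hf, mul_one, mul_one, RCLike.norm_ofReal, RCLike.norm_ofReal,
          abs_mul_abs_self, abs_mul_abs_self, ← hcd, sq, sq]
      · rw [inner_smul_left, inner_smul_right, hef, mul_zero, mul_zero]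
    exact (pow_eq_one_iff_of_nonneg (norm_nonneg _) two_ne_zero).1 hsq
  refine orthonormal_pair_iff.2 ⟨hnorm a b hab, ?_, ?_⟩
  · simpa using hnorm (-b) a (by linarith)
  · simp [inner_add_left, inner_add_right, inner_smul_left, inner_smul_right, hef, hfe,
      inner_self_eq_norm_sq_to_K, he, hf]
    ring

theorem exists_orthonormal_pair_norm_coord_ne (hE : 2 ≤ Module.finrank 𝕜 E) {v w : E} (hv : v ≠ 0)
    (hw : w ≠ 0) :
    ∃ e f : E, Orthonormal 𝕜 ![e, f] ∧ (∃ p q : 𝕜, v = p • e + q • f ∧ ‖p‖ ≠ ‖q‖) ∧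
      ∃ p q : 𝕜, w = p • e + q • f ∧ ‖p‖ ≠ ‖q‖ := by
  have : Nontrivial E := ⟨v, 0, hv⟩
  obtain ⟨e, he, hve⟩ := exists_norm_eq_one_eq_norm_smul 𝕜 v
  obtain ⟨f, hef, c, s, hwcs⟩ := exists_orthonormal_pair_eq_smul_add_smul hE he w
  by_cases hcs : ‖c‖ = ‖s‖
  · have hc : c ≠ 0 := by
      rintro rfl
      obtain rfl : s = 0 := by simpa [eq_comm] using hcs
      exact hw (by simpa using hwcs)
    have heg : Orthonormal 𝕜 ![e, (s / c) • f] := by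
      obtain ⟨-, hf, hef'⟩ := orthonormal_pair_iff.1 hef
      refine orthonormal_pair_iff.2 ⟨he, ?_, by rw [inner_smul_right, hef', mul_zero]⟩
      rw [norm_smul, norm_div, hf, ← hcs, div_self (norm_ne_zero_iff.2 hc), one_mul]
    have hwc : w = c • (e + (s / c) • f) := by
      rw [hwcs, smul_add, smul_smul c (s / c), mul_div_cancel₀ _ hc]
    have hrot := orthonormal_rotate heg (a := 3 / 5) (b := 4 / 5) (by norm_num)
    -- The coordinates of `v` stay unbalanced and those of `w` become so after this rotation.
    push_cast at hrot
    refine ⟨_, _, hrot, ⟨‖v‖ * (3 / 5), ‖v‖ * (-4 / 5), ?_, ?_⟩,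
      ⟨c * (7 / 5), c * (-1 / 5), ?_, ?_⟩⟩
    · conv_lhs => rw [hve]
      module
    · simp [hv]
    · rw [hwc]
      module
    · norm_num [hc]
  · exact ⟨e, f, hef, ⟨‖v‖, 0, by simpa using hve, by simpa using hv⟩, c, s, hwcs, hcs⟩

theorem exists_orthonormalBasis_apply_eq_of_injective [FiniteDimensional 𝕜 E] {ι κ : Type*}
    [Fintype ι] (hι : Module.finrank 𝕜 E = Fintype.card ι) {φ : κ → ι}
    (hφ : Function.Injective φ) {v : κ → E} (hv : Orthonormal 𝕜 v) :
    ∃ b : OrthonormalBasis ι 𝕜 E, ∀ k, b (φ k) = v k := by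
  have hres : (Set.range φ).domRestrict (Function.extend φ v 0) =
      v ∘ (Equiv.ofInjective φ hφ).symm := by
    rw [← Equiv.comp_symm_eq, Equiv.symm_symm]
    ext k
    simp [hφ.extend_apply]
  have hv' := hv.comp _ (Equiv.ofInjective φ hφ).symm.injective
  rw [← hres] at hv'
  obtain ⟨b, hb⟩ := hv'.exists_orthonormalBasis_extension_of_card_eq hι
  exact ⟨b, fun k => (hb _ ⟨k, rfl⟩).trans (hφ.extend_apply _ _ _)⟩

end OrthonormalPair

section Gram

variable {𝕜 E ι : Type*} [RCLike 𝕜] [NormedAddCommGroup E] [InnerProductSpace 𝕜 E]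

theorem norm_inner_le_half_add_sq (x y : E) : ‖inner 𝕜 x y‖ ≤ (‖x‖ ^ 2 + ‖y‖ ^ 2) / 2 := by
  linarith [norm_inner_le_norm (𝕜 := 𝕜) x y, two_mul_le_add_sq ‖x‖ ‖y‖]

theorem exists_norm_eq_one_eq_smul {x y : E} (h : (‖x‖ ^ 2 + ‖y‖ ^ 2) / 2 = ‖inner 𝕜 x y‖) :
    ∃ r : 𝕜, ‖r‖ = 1 ∧ y = r • x := by
  have hxy : ‖x‖ = ‖y‖ := by
    rw [← sub_eq_zero, ← sq_eq_zero_iff]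
    linarith [norm_inner_le_norm (𝕜 := 𝕜) x y, sub_sq ‖x‖ ‖y‖, sq_nonneg (‖x‖ - ‖y‖)]
  rcases eq_or_ne x 0 with rfl | hx
  · exact ⟨1, norm_one, by simpa [eq_comm] using hxy⟩
  have hy : y ≠ 0 := norm_ne_zero_iff.1 (hxy ▸ norm_ne_zero_iff.2 hx)
  obtain ⟨r, -, rfl⟩ := (norm_inner_eq_norm_iff (𝕜 := 𝕜) hx hy).1 (by rw [← h, ← hxy]; ring)
  refine ⟨r, ?_, rfl⟩
  rw [norm_smul] at hxy
  exact (mul_eq_right₀ (norm_ne_zero_iff.2 hx)).1 hxy.symm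

variable [Fintype ι]

theorem sum_half_add_sq (a : ι → ℝ) :
    ∑ i, ∑ j, (a i ^ 2 + a j ^ 2) / 2 = Fintype.card ι * ∑ i, a i ^ 2 := by
  simp only [← Finset.sum_div, Finset.sum_add_distrib, Finset.sum_const, Finset.card_univ,
    nsmul_eq_mul, ← Finset.mul_sum]
  ring

theorem sum_norm_inner_le (x : ι → E) :
    ∑ i, ∑ j, ‖inner 𝕜 (x i) (x j)‖ ≤ Fintype.card ι * ∑ i, ‖x i‖ ^ 2 := by
  rw [← sum_half_add_sq]
  gcongr
  exact norm_inner_le_half_add_sq _ _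

theorem exists_norm_eq_one_eq_smul_of_le_sum_norm_inner {x : ι → E}
    (h : Fintype.card ι * ∑ i, ‖x i‖ ^ 2 ≤ ∑ i, ∑ j, ‖inner 𝕜 (x i) (x j)‖) (i j : ι) :
    ∃ r : 𝕜, ‖r‖ = 1 ∧ x j = r • x i := by
  have hsum := (h.antisymm (sum_norm_inner_le x)).symm
  rw [← sum_half_add_sq,
    Finset.sum_eq_sum_iff_of_le fun k _ =>
      Finset.sum_le_sum fun l _ => norm_inner_le_half_add_sq _ _] at hsum
  have hrow := hsum i (Finset.mem_univ i)
  rw [Finset.sum_eq_sum_iff_of_le fun l _ => norm_inner_le_half_add_sq _ _] at hrow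
  exact exists_norm_eq_one_eq_smul (hrow j (Finset.mem_univ j)).symm

end Gram

section PosSemidefGram

open Matrix
open scoped ComplexOrder

variable {𝕜 n : Type*} [RCLike 𝕜] {A : Matrix n n 𝕜}

theorem exists_eq_gram_of_posSemidef [Finite n] (hA : A.PosSemidef) :
    ∃ (N : ℕ) (x : n → EuclideanSpace 𝕜 (Fin N)), A = gram 𝕜 x := by
  obtain ⟨N, v, rfl⟩ := posSemidef_iff_eq_sum_vecMulVec.1 hA
  refine ⟨N, fun i => WithLp.toLp 2 fun k => star (v k i), ?_⟩
  ext i j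
  simp [gram_apply, PiLp.inner_apply, Matrix.sum_apply, vecMulVec_apply, mul_comm]

variable [Fintype n]

theorem re_trace_gram {E : Type*} [NormedAddCommGroup E] [InnerProductSpace 𝕜 E] (x : n → E) :
    RCLike.re (gram 𝕜 x).trace = ∑ i, ‖x i‖ ^ 2 := by
  simp only [trace, diag_apply, gram_apply, map_sum, inner_self_eq_norm_sq]

theorem sum_norm_le_card_mul_re_trace (hA : A.PosSemidef) :
    ∑ i, ∑ j, ‖A i j‖ ≤ Fintype.card n * RCLike.re A.trace := by
  obtain ⟨N, x, rfl⟩ := exists_eq_gram_of_posSemidef hA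
  simpa only [gram_apply, re_trace_gram] using sum_norm_inner_le x

theorem exists_eq_smul_vecMulVec_of_card_mul_re_trace_le_sum_norm (hA : A.PosSemidef)
    (h : Fintype.card n * RCLike.re A.trace ≤ ∑ i, ∑ j, ‖A i j‖) :
    ∃ u : n → 𝕜, (∀ i, ‖u i‖ = 1) ∧ A = (A.trace / Fintype.card n) • vecMulVec u (star u) := by
  rcases isEmpty_or_nonempty n with _ | hn
  · exact ⟨0, isEmptyElim, Subsingleton.elim _ _⟩
  obtain ⟨z⟩ := id hn
  obtain ⟨N, x, rfl⟩ := exists_eq_gram_of_posSemidef hA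
  simp only [gram_apply, re_trace_gram] at h
  choose r hr hx using exists_norm_eq_one_eq_smul_of_le_sum_norm_inner h z
  have hgram : gram 𝕜 x = inner 𝕜 (x z) (x z) • vecMulVec (star r) (star (star r)) := by
    ext i j
    rw [gram_apply, hx i, hx j, inner_smul_left, inner_smul_right]
    simp only [Matrix.smul_apply, vecMulVec_apply, Pi.star_apply, star_star, RCLike.star_def,
      smul_eq_mul]
    ring
  have htr : (gram 𝕜 x).trace = Fintype.card n * inner 𝕜 (x z) (x z) := by
    rw [hgram, trace_smul, trace_vecMulVec, star_star, smul_eq_mul, mul_comm]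
    simp [dotProduct, RCLike.conj_mul, hr]
  refine ⟨star r, fun i => by simp [hr], ?_⟩
  rw [htr, mul_div_cancel_left₀ _ (Nat.cast_ne_zero.2 Fintype.card_ne_zero)]
  exact hgram

end PosSemidefGram

section ClosedCone

open Matrix
open scoped ComplexOrder

theorem isClosed_setOf_posSemidef {𝕜 n : Type*} [RCLike 𝕜] [Finite n] :
    IsClosed {A : Matrix n n 𝕜 | A.PosSemidef} := by
  cases nonempty_fintype n
  simp only [posSemidef_iff_dotProduct_mulVec, Set.ofPred_and, Set.ofPred_forall]
  exact (isClosed_eq (by fun_prop) continuous_id).inter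
    (isClosed_iInter fun x => isClosed_le continuous_const (by fun_prop))

end ClosedCone

section DiagonalMajorant

open Matrix
open scoped ComplexOrder

variable {𝕜 n : Type*} [RCLike 𝕜] [Fintype n] [DecidableEq n] {A B : Matrix n n 𝕜}

theorem posSemidef_of_sum_norm_le_re_diag (hA : A.IsHermitian)
    (h : ∀ i, ∑ j ∈ Finset.univ.erase i, ‖A i j‖ ≤ RCLike.re (A i i)) : A.PosSemidef := by
  refine hA.posSemidef_iff_eigenvalues_nonneg.2 fun k => ?_
  have heig : Module.End.HasEigenvalue (toLin' A) (hA.eigenvalues k : 𝕜) := by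
    rw [Module.End.hasEigenvalue_iff_mem_spectrum, spectrum_toLin', hA.spectrum_eq_image_range]
    exact ⟨_, ⟨k, rfl⟩, rfl⟩
  obtain ⟨i, hi⟩ := eigenvalue_mem_ball heig
  rw [mem_closedBall_iff_norm', ← hA.coe_re_apply_self i, ← RCLike.ofReal_sub,
    RCLike.norm_ofReal] at hi
  simpa using (le_abs_self _).trans (hi.trans (h i))

theorem posSemidef_diagonal_sum_norm_sub (hA : A.IsHermitian) :
    (diagonal (fun i => ((∑ j, ‖A i j‖ : ℝ) : 𝕜)) - A).PosSemidef := by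
  have hdiag : (diagonal fun i => ((∑ j, ‖A i j‖ : ℝ) : 𝕜)).IsHermitian :=
    isHermitian_diagonal_iff.2 fun i => RCLike.conj_ofReal _
  refine posSemidef_of_sum_norm_le_re_diag (hdiag.sub hA) fun i => ?_
  have hoff : ∑ j ∈ Finset.univ.erase i,
      ‖(diagonal (fun i => ((∑ j, ‖A i j‖ : ℝ) : 𝕜)) - A) i j‖ =
        ∑ j ∈ Finset.univ.erase i, ‖A i j‖ :=
    Finset.sum_congr rfl fun j hj => by
      rw [Matrix.sub_apply, diagonal_apply_ne' _ (Finset.ne_of_mem_erase hj), zero_sub, norm_neg]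
  rw [hoff, Matrix.sub_apply, diagonal_apply_eq, map_sub, RCLike.ofReal_re, le_sub_iff_add_le,
    ← Finset.sum_erase_add _ _ (Finset.mem_univ i)]
  gcongr
  exact RCLike.re_le_norm _

/-- The traces of the real diagonal matrices `Δ` with `A ≤ Δ` in the Loewner order. -/
def diagonalMajorantTraces (A : Matrix n n 𝕜) : Set ℝ :=
  {t | ∃ d : n → ℝ, (diagonal (fun i => (d i : 𝕜)) - A).PosSemidef ∧ ∑ i, d i = t}

theorem re_trace_le_of_mem_diagonalMajorantTraces {t : ℝ} (ht : t ∈ diagonalMajorantTraces A) :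
    RCLike.re A.trace ≤ t := by
  obtain ⟨d, hd, rfl⟩ := ht
  simpa [trace_sub, trace_diagonal] using (RCLike.nonneg_iff.1 hd.trace_nonneg).1

theorem re_trace_mem_diagonalMajorantTraces (hB : B.IsHermitian) (hdiag : B.IsDiag)
    (hAB : (B - A).PosSemidef) : RCLike.re B.trace ∈ diagonalMajorantTraces A := by
  refine ⟨fun i => RCLike.re (B i i), ?_, (map_sum RCLike.re _ _).symm⟩
  simp only [hB.coe_re_apply_self]
  exact hdiag.diagonal_diag.symm ▸ hAB

theorem bddBelow_diagonalMajorantTraces : BddBelow (diagonalMajorantTraces A) :=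
  ⟨_, fun _ => re_trace_le_of_mem_diagonalMajorantTraces⟩

theorem add_mem_diagonalMajorantTraces {s t : ℝ} (hs : s ∈ diagonalMajorantTraces A)
    (ht : t ∈ diagonalMajorantTraces B) : s + t ∈ diagonalMajorantTraces (A + B) := by
  obtain ⟨d, hd, rfl⟩ := hs
  obtain ⟨e, he, rfl⟩ := ht
  refine ⟨d + e, ?_, Finset.sum_add_distrib⟩
  simpa only [Pi.add_apply, RCLike.ofReal_add, ← diagonal_add, add_sub_add_comm] using hd.add he

theorem sum_norm_mem_diagonalMajorantTraces (hA : A.IsHermitian) :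
    ∑ i, ∑ j, ‖A i j‖ ∈ diagonalMajorantTraces A :=
  ⟨_, posSemidef_diagonal_sum_norm_sub hA, rfl⟩

/-- The least trace of a real diagonal matrix that dominates `A` in the Loewner order. For a
density matrix it is `1` plus the unnormalized robustness of coherence. -/
noncomputable def diagonalMajorantTrace (A : Matrix n n 𝕜) : ℝ :=
  sInf (diagonalMajorantTraces A)

theorem isGLB_diagonalMajorantTrace (hA : A.IsHermitian) :
    IsGLB (diagonalMajorantTraces A) (diagonalMajorantTrace A) :=
  isGLB_csInf ⟨_, sum_norm_mem_diagonalMajorantTraces hA⟩ bddBelow_diagonalMajorantTraces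

theorem re_trace_le_diagonalMajorantTrace (hA : A.IsHermitian) :
    RCLike.re A.trace ≤ diagonalMajorantTrace A :=
  (isGLB_diagonalMajorantTrace hA).2 fun _ => re_trace_le_of_mem_diagonalMajorantTraces

theorem diagonalMajorantTrace_le_sum_norm (hA : A.IsHermitian) :
    diagonalMajorantTrace A ≤ ∑ i, ∑ j, ‖A i j‖ :=
  csInf_le bddBelow_diagonalMajorantTraces (sum_norm_mem_diagonalMajorantTraces hA)

theorem diagonalMajorantTrace_add_le (hA : A.IsHermitian) (hB : B.IsHermitian) :
    diagonalMajorantTrace (A + B) ≤ diagonalMajorantTrace A + diagonalMajorantTrace B := by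
  refine le_of_forall_pos_lt_add fun ε hε => ?_
  obtain ⟨s, hs, -, hsε⟩ := (isGLB_diagonalMajorantTrace hA).exists_between_self_add (half_pos hε)
  obtain ⟨t, ht, -, htε⟩ := (isGLB_diagonalMajorantTrace hB).exists_between_self_add (half_pos hε)
  calc diagonalMajorantTrace (A + B)
      ≤ s + t := csInf_le bddBelow_diagonalMajorantTraces (add_mem_diagonalMajorantTraces hs ht)
    _ < diagonalMajorantTrace A + diagonalMajorantTrace B + ε := by linarith

open scoped Matrix.Norms.Elementwise in
theorem continuousOn_diagonalMajorantTrace :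
    ContinuousOn diagonalMajorantTrace {A : Matrix n n 𝕜 | A.IsHermitian} := by
  refine (LipschitzOnWith.of_le_add_mul (Fintype.card n * Fintype.card n)
    fun A hA B hB => ?_).continuousOn
  calc diagonalMajorantTrace A
      ≤ diagonalMajorantTrace B + diagonalMajorantTrace (A - B) := by
        simpa using diagonalMajorantTrace_add_le hB (hA.sub hB)
    _ ≤ diagonalMajorantTrace B + ∑ i, ∑ j, ‖(A - B) i j‖ := by
        gcongr
        exact diagonalMajorantTrace_le_sum_norm (hA.sub hB)
    _ ≤ diagonalMajorantTrace B + ∑ _i : n, ∑ _j : n, ‖A - B‖ := by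
        gcongr
        exact norm_entry_le_entrywise_sup_norm _
    _ = _ := by simp [dist_eq_norm, mul_assoc]

end DiagonalMajorant

namespace QuantumMemory

open Matrix

variable {D : ℕ}

namespace Channel

variable (M : Channel D)

theorem trace_apply (A : Op D) : (M A).trace = A.trace :=
  M.trace_map A

theorem exists_isKrausFamily : ∃ K : Fin D × Fin D → Op D, IsKrausFamily K M :=
  _root_.exists_isKrausFamily M.toCompletelyPositiveMap

theorem continuous : Continuous M := by
  obtain ⟨K, hK⟩ := M.exists_isKrausFamily
  exact hK.continuous

theorem map_mem_states {ρ : Op D} (hρ : ρ ∈ states D) : M ρ ∈ states D := by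
  obtain ⟨K, hK⟩ := M.exists_isKrausFamily
  exact ⟨hK.posSemidef_map hρ.1, (M.trace_apply ρ).trans hρ.2⟩

variable {M} in
theorem isUnitary_of_isKrausFamily_smul {ι : Type*} [Fintype ι] {a : ι → ℂ} {V : Op D}
    (hK : IsKrausFamily (fun i => a i • V) M) : M.IsUnitary := by
  obtain ⟨W, hW⟩ := hK.exists_map_eq_mul_mul_conjTranspose
  have hWW : Wᴴ * W = 1 := conjTranspose_mul_self_eq_one_of_trace_mul_mul_conjTranspose
    fun A => hW A ▸ M.trace_apply A
  exact ⟨⟨W, mem_unitaryGroup_iff'.2 hWW⟩, hW⟩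

theorem isUnitary_or_exists_dotProduct [NeZero D] :
    M.IsUnitary ∨ ∃ v ≠ (0 : Fin D → ℂ), ∃ w ≠ (0 : Fin D → ℂ), ∀ ρ ∈ states D, ∀ y : Fin D → ℂ,
      M ρ = vecMulVec y (star y) → v ⬝ᵥ y = 0 ∨ w ⬝ᵥ y = 0 := by
  obtain ⟨K, hK⟩ := M.exists_isKrausFamily
  rcases exists_dual_or_exists_map_eq_smul rfl (T := fun i => (K i).mulVecLin)
    fun x hx => hK.exists_mulVec_ne_zero M.trace_apply hx with ⟨f, hf, g, hg, h⟩ | ⟨a, V, h⟩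
  · obtain ⟨v, rfl⟩ := (dotProductEquiv ℂ (Fin D)).surjective f
    obtain ⟨w, rfl⟩ := (dotProductEquiv ℂ (Fin D)).surjective g
    refine Or.inr ⟨v, by simpa using hf, w, by simpa using hg, fun ρ hρ y hy => ?_⟩
    have hρ0 : ρ ≠ 0 := by
      rintro rfl
      simpa using hρ.2
    exact h y (hK.mem_pureOutputs hρ.1 hρ0 hy)
  · have hKV : K = fun i => a i • LinearMap.toMatrix' V := funext fun i => by
      rw [← map_smul, ← h, ← toLin'_apply', LinearMap.toMatrix'_toLin']
    exact Or.inl (isUnitary_of_isKrausFamily_smul (hKV ▸ hK))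

end Channel

section MaximallyCoherent

/-- The vector of phases `e ^ (i α_j)`, which is `√D` times a maximally coherent vector written in
its own basis. -/
noncomputable def phaseVec (α : Fin D → ℝ) : Fin D → ℂ :=
  fun j => Complex.exp (α j * Complex.I)

theorem norm_phaseVec (α : Fin D → ℝ) (j : Fin D) : ‖phaseVec α j‖ = 1 :=
  Complex.norm_exp_ofReal_mul_I (α j)

theorem exists_eq_phaseVec {u : Fin D → ℂ} (hu : ∀ j, ‖u j‖ = 1) : ∃ α, u = phaseVec α := by
  choose α hα using fun j => (Complex.norm_eq_one_iff (u j)).1 (hu j)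
  exact ⟨α, funext fun j => (hα j).symm⟩

theorem maxCohVec_eq (U : Uni D) (α : Fin D → ℝ) :
    maxCohVec U α = ((√D : ℝ) : ℂ)⁻¹ • (U : Op D) *ᵥ phaseVec α :=
  rfl

theorem dotProduct_maxCohVec_ne_zero {U : Uni D} {v : Fin D → ℂ} {i j : Fin D} {p q : ℂ}
    (hv : v ᵥ* (U : Op D) = p • Pi.single i 1 + q • Pi.single j 1) (hpq : ‖p‖ ≠ ‖q‖)
    (α : Fin D → ℝ) : v ⬝ᵥ maxCohVec U α ≠ 0 := by
  have hD : ((√D : ℝ) : ℂ)⁻¹ ≠ 0 := by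
    have : NeZero D := ⟨i.pos.ne'⟩
    simp [NeZero.ne D]
  have hcoord : v ⬝ᵥ maxCohVec U α =
      ((√D : ℝ) : ℂ)⁻¹ * (p * phaseVec α i + q * phaseVec α j) := by
    rw [maxCohVec_eq, dotProduct_smul, dotProduct_mulVec, hv, add_dotProduct, smul_dotProduct,
      smul_dotProduct, single_one_dotProduct, single_one_dotProduct]
    simp only [smul_eq_mul]
  rw [hcoord]
  refine mul_ne_zero hD fun h => hpq ?_
  simpa [norm_phaseVec] using congrArg norm (eq_neg_of_add_eq_zero_left h)

theorem exists_uni_vecMul_eq (b : OrthonormalBasis (Fin D) ℂ (EuclideanSpace ℂ (Fin D))) :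
    ∃ U : Uni D, ∀ (v : Fin D → ℂ) (i j : Fin D) (p q : ℂ),
      WithLp.toLp 2 (star v) = p • b i + q • b j →
        v ᵥ* (U : Op D) = star p • Pi.single i 1 + star q • Pi.single j 1 := by
  refine ⟨⟨(EuclideanSpace.basisFun (Fin D) ℂ).toBasis.toMatrix b,
    (EuclideanSpace.basisFun (Fin D) ℂ).toMatrix_orthonormalBasis_mem_unitary b⟩,
    fun v i j p q hv => funext fun k => ?_⟩
  calc (v ᵥ* (EuclideanSpace.basisFun (Fin D) ℂ).toBasis.toMatrix b) k
      = inner ℂ (WithLp.toLp 2 (star v)) (b k) := by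
        rw [EuclideanSpace.inner_eq_star_dotProduct, star_star, dotProduct_comm]
        rfl
    _ = (star p • Pi.single i 1 + star q • Pi.single j 1 : Fin D → ℂ) k := by
        simp [hv, b.inner_eq_ite, Pi.single_apply, eq_comm]

theorem exists_forall_dotProduct_maxCohVec_ne_zero (hD : 2 ≤ D) {v w : Fin D → ℂ} (hv : v ≠ 0)
    (hw : w ≠ 0) :
    ∃ U : Uni D, ∀ α, v ⬝ᵥ maxCohVec U α ≠ 0 ∧ w ⬝ᵥ maxCohVec U α ≠ 0 := by
  have hfin : Module.finrank ℂ (EuclideanSpace ℂ (Fin D)) = Fintype.card (Fin D) := by simp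
  obtain ⟨e, f, hef, ⟨p, q, hv', hpq⟩, r, s, hw', hrs⟩ :=
    exists_orthonormal_pair_norm_coord_ne (𝕜 := ℂ) (by simpa using hD)
      (v := WithLp.toLp 2 (star v)) (w := WithLp.toLp 2 (star w)) (by simpa using hv)
      (by simpa using hw)
  obtain ⟨b, hb⟩ := exists_orthonormalBasis_apply_eq_of_injective hfin
    (Fin.castLE_injective hD) hef
  obtain ⟨U, hU⟩ := exists_uni_vecMul_eq b
  obtain ⟨rfl, rfl⟩ : b (Fin.castLE hD 0) = e ∧ b (Fin.castLE hD 1) = f := ⟨hb 0, hb 1⟩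
  exact ⟨U, fun α =>
    ⟨dotProduct_maxCohVec_ne_zero (hU v _ _ p q hv') (by simpa using hpq) α,
      dotProduct_maxCohVec_ne_zero (hU w _ _ r s hw') (by simpa using hrs) α⟩⟩

theorem Channel.isUnitary_of_forall_exists_maxCoh (hD : 2 ≤ D) {M : Channel D}
    (h : ∀ U, ∃ ρ ∈ states D, ∃ α, M ρ = maxCoh U α) : M.IsUnitary := by
  have : NeZero D := ⟨by omega⟩
  refine M.isUnitary_or_exists_dotProduct.resolve_right ?_
  rintro ⟨v, hv, w, hw, hvw⟩
  obtain ⟨U, hU⟩ := exists_forall_dotProduct_maxCohVec_ne_zero hD hv hw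
  obtain ⟨ρ, hρ, α, hα⟩ := h U
  exact (hvw ρ hρ _ hα).elim (hU α).1 (hU α).2

end MaximallyCoherent

section States

open scoped ComplexOrder

theorem norm_apply_le_of_mem_states {ρ : Op D} (hρ : ρ ∈ states D) (i j : Fin D) :
    ‖ρ i j‖ ≤ D := by
  calc ‖ρ i j‖ ≤ ∑ i, ∑ j, ‖ρ i j‖ :=
        (Finset.single_le_sum (f := fun j => ‖ρ i j‖) (fun _ _ => norm_nonneg _)
          (Finset.mem_univ j)).trans
          (Finset.single_le_sum (f := fun i => ∑ j, ‖ρ i j‖)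
            (fun _ _ => Finset.sum_nonneg fun _ _ => norm_nonneg _) (Finset.mem_univ i))
    _ ≤ D := by simpa [hρ.2] using sum_norm_le_card_mul_re_trace hρ.1

theorem isClosed_states : IsClosed (states D) :=
  isClosed_setOf_posSemidef.inter (isClosed_eq (by fun_prop) continuous_const)

theorem isCompact_states : IsCompact (states D) :=
  (isCompact_univ_pi fun _ => isCompact_univ_pi fun _ =>
    isCompact_closedBall (0 : ℂ) D).of_isClosed_subset isClosed_states fun _ hρ i _ j _ =>
      mem_closedBall_zero_iff.2 (norm_apply_le_of_mem_states hρ i j)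

theorem exists_mem_states_eq_re_trace_smul (h : (states D).Nonempty) {P : Op D}
    (hP : P.PosSemidef) : ∃ τ ∈ states D, P = P.trace.re • τ := by
  have htrace : (P.trace.re : ℂ) = P.trace :=
    Complex.ext rfl (Complex.nonneg_iff.1 hP.trace_nonneg).2
  rcases eq_or_ne P.trace 0 with h0 | h0
  · obtain ⟨τ, hτ⟩ := h
    exact ⟨τ, hτ, by rw [h0, Complex.zero_re, zero_smul, hP.trace_eq_zero_iff.1 h0]⟩
  · refine ⟨P.trace⁻¹ • P, ⟨hP.smul (inv_nonneg.2 hP.trace_nonneg), ?_⟩, ?_⟩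
    · rw [trace_smul, smul_eq_mul, inv_mul_cancel₀ h0]
    · rw [← Complex.coe_smul, htrace, smul_inv_smul₀ h0]

theorem inv_smul_add_smul_mem_states {ρ τ : Op D} (hρ : ρ ∈ states D) (hτ : τ ∈ states D) {s : ℝ}
    (hs : 0 ≤ s) : (1 + s)⁻¹ • (ρ + s • τ) ∈ states D := by
  refine ⟨(hρ.1.add (hτ.1.smul hs)).smul (by positivity), ?_⟩
  have hs' : (1 : ℝ) + s ≠ 0 := by positivity
  rw [trace_smul, trace_add, trace_smul, hρ.2, hτ.2, Complex.real_smul, Complex.real_smul]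
  norm_cast
  rw [mul_one, inv_mul_cancel₀ hs']

end States

section Robustness

open scoped ComplexOrder

/-- Passage to the matrix `Uᴴ * ρ * U` of `ρ` in the basis `U |j⟩`. -/
noncomputable def inBasis (U : Uni D) : Op D ≃⋆ₐ[ℝ] Op D :=
  Unitary.conjStarAlgAut ℝ (Op D) (star U)

theorem inBasis_apply (U : Uni D) (ρ : Op D) :
    inBasis U ρ = (U : Op D)ᴴ * ρ * (U : Op D) :=
  Unitary.conjStarAlgAut_star_apply U ρ

theorem inBasis_symm_apply (U : Uni D) (ρ : Op D) :
    (inBasis U).symm ρ = (U : Op D) * ρ * (U : Op D)ᴴ := by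
  simp [inBasis, star_eq_conjTranspose]

theorem continuous_inBasis (U : Uni D) : Continuous (inBasis U) := by
  simp only [funext (inBasis_apply U)]
  fun_prop

theorem inBasis_mem_states {U : Uni D} {ρ : Op D} : inBasis U ρ ∈ states D ↔ ρ ∈ states D := by
  have htrace : (inBasis U ρ).trace = ρ.trace := by
    rw [inBasis_apply, trace_mul_comm, ← mul_assoc, ← star_eq_conjTranspose,
      mem_unitaryGroup_iff.1 U.2, one_mul]
  have hpos : (inBasis U ρ).PosSemidef ↔ ρ.PosSemidef :=
    inBasis_apply U ρ ▸ IsUnit.posSemidef_star_left_conjugate_iff Unitary.isUnit_coe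
  exact and_congr hpos (by rw [htrace])

theorem one_add_mem_diagonalMajorantTraces_iff {A : Op D} (hA : A ∈ states D) {s : ℝ} :
    1 + s ∈ diagonalMajorantTraces A ↔ 0 ≤ s ∧ ∃ B ∈ states D, (A + s • B).IsDiag := by
  constructor
  · intro h
    have hs : 0 ≤ s := by simpa [hA.2] using re_trace_le_of_mem_diagonalMajorantTraces h
    obtain ⟨d, hd, hsum⟩ := h
    obtain ⟨B, hB, hdB⟩ := exists_mem_states_eq_re_trace_smul ⟨A, hA⟩ hd
    have htrace : (diagonal (fun i => RCLike.ofReal (d i)) - A).trace.re = s := by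
      simp [trace_sub, trace_diagonal, hA.2, hsum]
    rw [htrace] at hdB
    exact ⟨hs, B, hB, by simp [← hdB]⟩
  · rintro ⟨hs, B, hB, hdiag⟩
    have hsB : (s • B).PosSemidef := hB.1.smul hs
    simpa [trace_add, hA.2, hB.2] using re_trace_mem_diagonalMajorantTraces
      (hA.1.1.add hsB.1) hdiag (by rwa [add_sub_cancel_left])

theorem inv_smul_add_smul_mem_incoherent_iff {U : Uni D} {ρ τ : Op D} (hρ : ρ ∈ states D)
    (hτ : τ ∈ states D) {s : ℝ} (hs : 0 ≤ s) :
    (1 + s)⁻¹ • (ρ + s • τ) ∈ incoherent U ↔ (inBasis U ρ + s • inBasis U τ).IsDiag := by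
  have hs' : 1 + s ≠ 0 := by positivity
  have hmem : (1 + s)⁻¹ • (ρ + s • τ) ∈ incoherent U ↔
      (inBasis U ((1 + s)⁻¹ • (ρ + s • τ))).IsDiag := by
    rw [inBasis_apply]
    exact and_iff_right (inv_smul_add_smul_mem_states hρ hτ hs)
  rw [hmem, map_smul (inBasis U), map_add, map_smul (inBasis U)]
  exact ⟨fun h => by simpa only [smul_inv_smul₀ hs'] using h.smul (1 + s), fun h => h.smul _⟩

theorem robustness_eq {U : Uni D} {ρ : Op D} (hρ : ρ ∈ states D) :
    robustness U ρ = (diagonalMajorantTrace (inBasis U ρ) - 1) / (D - 1) := by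
  have hρ' := inBasis_mem_states (U := U).2 hρ
  have hset : {s : ℝ | 0 ≤ s ∧ ∃ τ ∈ states D, (1 + s)⁻¹ • (ρ + s • τ) ∈ incoherent U} =
      OrderIso.addLeft 1 ⁻¹' diagonalMajorantTraces (inBasis U ρ) := by
    ext s
    rw [Set.mem_preimage, OrderIso.addLeft_apply, one_add_mem_diagonalMajorantTraces_iff hρ']
    refine and_congr_right fun hs =>
      (exists_congr fun τ => ?_).trans (EquivLike.surjective (inBasis U)).exists.symm
    rw [inBasis_mem_states]
    exact and_congr_right fun hτ => inv_smul_add_smul_mem_incoherent_iff hρ hτ hs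
  have hglb := (OrderIso.addLeft (1 : ℝ)).isGLB_preimage'.2 (isGLB_diagonalMajorantTrace hρ'.1.1)
  have hne : (diagonalMajorantTraces (inBasis U ρ)).Nonempty :=
    ⟨_, sum_norm_mem_diagonalMajorantTraces hρ'.1.1⟩
  rw [robustness, hset, hglb.csInf_eq (hne.preimage (OrderIso.addLeft 1).surjective)]
  simp [neg_add_eq_sub, div_eq_inv_mul]

theorem diagonalMajorantTrace_mem_Icc {A : Op D} (hA : A ∈ states D) :
    diagonalMajorantTrace A ∈ Set.Icc 1 (D : ℝ) := by
  constructor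
  · simpa [hA.2] using re_trace_le_diagonalMajorantTrace hA.1.1
  · simpa [hA.2] using
      (diagonalMajorantTrace_le_sum_norm hA.1.1).trans (sum_norm_le_card_mul_re_trace hA.1)

theorem robustness_mem_Icc (U : Uni D) {ρ : Op D} (hρ : ρ ∈ states D) :
    robustness U ρ ∈ Set.Icc 0 1 := by
  obtain ⟨hlower, hupper⟩ := diagonalMajorantTrace_mem_Icc (inBasis_mem_states (U := U).2 hρ)
  rw [robustness_eq hρ]
  exact ⟨div_nonneg (sub_nonneg.2 hlower) (by linarith),
    div_le_one_of_le₀ (by linarith) (by linarith)⟩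

theorem continuousOn_robustness (U : Uni D) : ContinuousOn (robustness U) (states D) := by
  have hmaps : Set.MapsTo (inBasis U) (states D) {A | A.IsHermitian} := fun ρ hρ =>
    (inBasis_mem_states.2 hρ).1.1
  exact (((continuousOn_diagonalMajorantTrace.comp (continuous_inBasis U).continuousOn
    hmaps).sub continuousOn_const).div_const _).congr fun ρ hρ => robustness_eq hρ

theorem maxCoh_eq (U : Uni D) (α : Fin D → ℝ) :
    maxCoh U α = (inBasis U).symm ((D : ℂ)⁻¹ • vecMulVec (phaseVec α) (star (phaseVec α))) := by
  have hsqrt : ((√D : ℝ) : ℂ)⁻¹ * ((√D : ℝ) : ℂ)⁻¹ = (D : ℂ)⁻¹ := by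
    rw [← mul_inv, ← Complex.ofReal_mul, Real.mul_self_sqrt D.cast_nonneg, Complex.ofReal_natCast]
  rw [maxCoh, maxCohVec_eq, inBasis_symm_apply, Matrix.mul_smul, Matrix.smul_mul,
    mul_vecMulVec_star_mul_conjTranspose, star_smul, smul_vecMulVec, vecMulVec_smul, smul_smul,
    star_inv₀, RCLike.star_def, Complex.conj_ofReal, hsqrt]

theorem maxCoh_mem_states [NeZero D] (U : Uni D) (α : Fin D → ℝ) : maxCoh U α ∈ states D := by
  rw [← inBasis_mem_states (U := U), maxCoh_eq, StarAlgEquiv.apply_symm_apply]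
  refine ⟨(posSemidef_vecMulVec_self_star _).smul (by positivity), ?_⟩
  simp [trace_vecMulVec, dotProduct, Complex.mul_conj', norm_phaseVec, NeZero.ne D]

theorem exists_eq_maxCoh_of_robustness_eq_one (hD : 2 ≤ D) {U : Uni D} {ρ : Op D}
    (hρ : ρ ∈ states D) (h : robustness U ρ = 1) : ∃ α, ρ = maxCoh U α := by
  have hρ' := inBasis_mem_states (U := U).2 hρ
  have hD' : (D : ℝ) - 1 ≠ 0 := sub_ne_zero.2 (by exact_mod_cast (by omega : D ≠ 1))
  have hmax : diagonalMajorantTrace (inBasis U ρ) = D := by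
    rw [robustness_eq hρ, div_eq_one_iff_eq hD'] at h
    linarith
  have hnorm : (Fintype.card (Fin D) : ℝ) * RCLike.re (inBasis U ρ).trace ≤
      ∑ i, ∑ j, ‖inBasis U ρ i j‖ := by
    simpa [hρ'.2, hmax] using diagonalMajorantTrace_le_sum_norm hρ'.1.1
  obtain ⟨u, hu, hρu⟩ := exists_eq_smul_vecMulVec_of_card_mul_re_trace_le_sum_norm hρ'.1 hnorm
  obtain ⟨α, rfl⟩ := exists_eq_phaseVec hu
  refine ⟨α, EquivLike.injective (inBasis U) ?_⟩
  rw [maxCoh_eq, StarAlgEquiv.apply_symm_apply, hρu, hρ'.2, Fintype.card_fin, one_div]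

end Robustness

section Quantities

variable {C : Uni D → Op D → ℝ} (hC : ∀ U, ∀ ρ ∈ states D, C U ρ ∈ Set.Icc 0 1)
  (M : Channel D)

include hC

theorem iSup_states_nonneg (U : Uni D) : 0 ≤ ⨆ ρ : states D, C U (M ρ) :=
  Real.iSup_nonneg fun ρ => (hC U _ (M.map_mem_states ρ.2)).1

variable [NeZero D]

theorem iSup_maxCoh_nonneg (U U' : Uni D) : 0 ≤ ⨆ α, C U' (M (maxCoh U α)) :=
  Real.iSup_nonneg fun α => (hC U' _ (M.map_mem_states (maxCoh_mem_states U α))).1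

theorem iSup_maxCoh_le_iSup_states (U U' : Uni D) :
    ⨆ α, C U' (M (maxCoh U α)) ≤ ⨆ ρ : states D, C U' (M ρ) := by
  have hbdd : BddAbove (Set.range fun ρ : states D => C U' (M ρ)) :=
    ⟨1, Set.forall_mem_range.2 fun ρ => (hC U' _ (M.map_mem_states ρ.2)).2⟩
  exact ciSup_le fun α => le_ciSup hbdd ⟨_, maxCoh_mem_states U α⟩

theorem Qminus_le_Qzero : Qminus C M ≤ Qzero C M :=
  le_ciInf fun U => ciInf_le (f := fun UU : Uni D × Uni D => ⨆ α, C UU.2 (M (maxCoh UU.1 α)))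
    ⟨0, Set.forall_mem_range.2 fun UU => iSup_maxCoh_nonneg hC M UU.1 UU.2⟩ (U, U)

theorem Qzero_le_Qplus : Qzero C M ≤ Qplus C M :=
  ciInf_mono ⟨0, Set.forall_mem_range.2 fun U => iSup_maxCoh_nonneg hC M U U⟩
    fun U => iSup_maxCoh_le_iSup_states hC M U U

theorem one_le_Qplus (h : Qminus C M = 1 ∨ Qzero C M = 1 ∨ Qplus C M = 1) : 1 ≤ Qplus C M := by
  rcases h with h | h | h
  · exact h ▸ (Qminus_le_Qzero hC M).trans (Qzero_le_Qplus hC M)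
  · exact h ▸ Qzero_le_Qplus hC M
  · exact h.ge

theorem exists_eq_one_of_one_le_Qplus (husc : ∀ U, UpperSemicontinuousOn (C U) (states D))
    (h : 1 ≤ Qplus C M) (U : Uni D) : ∃ ρ ∈ states D, C U (M ρ) = 1 := by
  have hne : (states D).Nonempty := ⟨_, maxCoh_mem_states U 0⟩
  obtain ⟨ρ, hρ, hmax⟩ := ((husc U).comp M.continuous.continuousOn
    fun ρ hρ => M.map_mem_states hρ).exists_isMaxOn hne isCompact_states
  have : Nonempty (states D) := hne.to_subtype
  refine ⟨ρ, hρ, (hC U _ (M.map_mem_states hρ)).2.antisymm ?_⟩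
  calc 1 ≤ Qplus C M := h
    _ ≤ ⨆ ρ : states D, C U (M ρ) :=
      ciInf_le ⟨0, Set.forall_mem_range.2 (iSup_states_nonneg hC M)⟩ U
    _ ≤ C U (M ρ) := ciSup_le fun σ => hmax σ.2

end Quantities

end QuantumMemory

open QuantumMemory in
theorem theorem6_general {D : ℕ} (hD : 2 ≤ D) (M : Channel D) {C : Uni D → Op D → ℝ}
    (hC : ∀ U, ∀ ρ ∈ states D, C U ρ ∈ Set.Icc 0 1)
    (husc : ∀ U, UpperSemicontinuousOn (C U) (states D))
    (hone : ∀ U, ∀ ρ ∈ states D, C U ρ = 1 → ∃ α, ρ = maxCoh U α)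
    (h : Qminus C M = 1 ∨ Qzero C M = 1 ∨ Qplus C M = 1) : M.IsUnitary := by
  have : NeZero D := ⟨by omega⟩
  refine Channel.isUnitary_of_forall_exists_maxCoh hD fun U => ?_
  obtain ⟨ρ, hρ, hρU⟩ := exists_eq_one_of_one_le_Qplus hC M husc (one_le_Qplus hC M h) U
  exact ⟨ρ, hρ, hone U _ (M.map_mem_states hρ) hρU⟩

theorem theorem6 (D : ℕ) (hD : 2 ≤ D) (M : QuantumMemory.Channel D) :
    ((QuantumMemory.Qminus QuantumMemory.robustness M = 1 ∨
        QuantumMemory.Qzero QuantumMemory.robustness M = 1 ∨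
        QuantumMemory.Qplus QuantumMemory.robustness M = 1) → M.IsUnitary) ∧
    (∀ C : QuantumMemory.Uni D → QuantumMemory.Op D → ℝ, QuantumMemory.IsCoherenceMeasure C →
      (QuantumMemory.Qminus C M = 1 ∨ QuantumMemory.Qzero C M = 1 ∨
        QuantumMemory.Qplus C M = 1) → M.IsUnitary) :=
  ⟨theorem6_general hD M (fun U _ => QuantumMemory.robustness_mem_Icc U)
      (fun U => (QuantumMemory.continuousOn_robustness U).upperSemicontinuousOn)
      fun _ _ => QuantumMemory.exists_eq_maxCoh_of_robustness_eq_one hD,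
    fun _ hC => theorem6_general hD M hC.mem_Icc
      (fun U => (hC.continuousOn U).upperSemicontinuousOn)
      fun U ρ hρ => (hC.eq_one_iff U ρ hρ).1⟩
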